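/- Let $k \ge 2$ be an integer and let $G$ be a $k$-connected finite simple graph on $n$ vertices, that is, $n > k$ and $G - X$ is connected for every set $X$ of fewer than $k$ vertices. For a path $P$ in $G$ (a single vertex is a path of length $0$), put $$\mathrm{ecc}_G(P) = \max_{u \in V(G)} \ \min_{v \in V(P)} d_G(u,v),$$ where $d_G$ denotes the graph distance, and let the path eccentricity of $G$ be $$\mathrm{pe}(G) = \min\{\mathrm{ecc}_G(P) : P \text{ is a path in } G\}.$$ Then $$\mathrm{pe}(G) \le \frac{n+k}{3k+2}.$$ -/

import Mathlib

namespace SimpleGraph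

/-- `G` is `k`-connected: it has more than `k` vertices, and deleting fewer than `k` vertices
always leaves a connected graph. -/
def IsKConnected {V : Type*} [Fintype V] (G : SimpleGraph V) (k : ℕ) : Prop :=
  k < Fintype.card V ∧
    ∀ X : Finset V, X.card < k → (G.induce {v : V | v ∉ X}).Connected

/-- The distance `d_G(u, S) = min {d_G(u, v) : v ∈ S}` from a vertex to a set of vertices
(for `G` connected and `S` nonempty). -/
noncomputable def distToSet {V : Type*} (G : SimpleGraph V) (u : V) (S : Set V) : ℕ :=
  sInf {d : ℕ | ∃ v ∈ S, G.dist u v = d}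

/-- The eccentricity `ecc_G(S) = max {d_G(u, S) : u ∈ V(G)}` of a vertex set. -/
noncomputable def setEccentricity {V : Type*} [Fintype V] (G : SimpleGraph V) (S : Set V) : ℕ :=
  Finset.univ.sup fun u : V => G.distToSet u S

/-- The path eccentricity `pe(G) = min {ecc_G(V(P)) : P a path in G}`;
a single vertex counts as a path. -/
noncomputable def pathEccentricity {V : Type*} [Fintype V] (G : SimpleGraph V) : ℕ :=
  sInf {e : ℕ | ∃ (a b : V) (p : G.Walk a b),
    p.IsPath ∧ G.setEccentricity {v : V | v ∈ p.support} = e}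

end SimpleGraph

namespace SimpleGraph

/-! ### Menger's theorem for directed edge sets -/

section Menger

variable {V : Type*}

/-! Take a longest path `L` and a vertex `u` at distance at least `r = pe(G) ≥ 1` from it. The fan
lemma `IsKConnected.exists_fan` joins `u` to `k` distinct vertices of `L` by paths with at least `r
- 1` inner vertices each. Two of these paths form a detour through `u` with at least `2r - 1` inner
vertices, all off `L`. As `L` is longest, no detour can improve it, so at least `2r - 1` vertices of
`L` lie between any two feet of the fan, before the first foot and after the last. Counting `L`, `u`
and the fan gives `n ≥ (3k + 2)r - k` (`IsKConnected.card_ge_of_dist_maximal`).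

The fan lemma comes from the directed Menger theorem `exists_disjoint_links`, proved by induction on
the edge set. -/

theorem exists_first_mem_split (p : V → Prop) (l : List V) (h : ∃ v ∈ l, p v) :
    ∃ s v t, l = s ++ v :: t ∧ p v ∧ ∀ w ∈ s, ¬ p w := by
  induction l with
  | nil => simp at h
  | cons a l ih =>
    by_cases ha : p a
    · exact ⟨[], a, l, rfl, ha, by simp⟩
    · obtain ⟨s, v, t, rfl, hv, hs⟩ := ih (by simpa [ha] using h)
      exact ⟨a :: s, v, t, rfl, hv, by simpa [ha] using hs⟩

theorem exists_last_mem_split (p : V → Prop) (l : List V) (h : ∃ v ∈ l, p v) :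
    ∃ s v t, l = s ++ v :: t ∧ p v ∧ ∀ w ∈ t, ¬ p w := by
  obtain ⟨s, v, t, hl, hv, hs⟩ := exists_first_mem_split p l.reverse (by simpa using h)
  refine ⟨t.reverse, v, s.reverse, ?_, hv, by simpa using hs⟩
  rw [← List.reverse_reverse l, hl]
  simp

theorem exists_append_eq_concat {s t t' : List V} {v b : V} (h : s ++ v :: t = t' ++ [b])
    (s' : List V) : ∃ r, s' ++ v :: t = r ++ [b] := by
  rcases List.eq_nil_or_concat t with rfl | ⟨t₀, c, rfl⟩
  · have := (List.append_inj' h rfl).2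
    exact ⟨s', by rw [this]⟩
  · have h' : (s ++ v :: t₀) ++ [c] = t' ++ [b] := by simpa using h
    have := (List.append_inj' h' rfl).2
    exact ⟨s' ++ v :: t₀, by rw [List.append_assoc, ← this]; simp⟩

/-- `l` is the vertex list of a directed walk from `A` to `B` along the edges in `E`. -/
def IsLink (E : Finset (V × V)) (A B : Finset V) (l : List V) : Prop :=
  l.IsChain (fun a b => (a, b) ∈ E) ∧ (∃ a ∈ A, ∃ t, l = a :: t) ∧ ∃ b ∈ B, ∃ s, l = s ++ [b]

/-- Every walk from `A` to `B` along the edges in `E` meets `S`. -/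
def Separates (E : Finset (V × V)) (A B S : Finset V) : Prop :=
  ∀ l, IsLink E A B l → ∃ v ∈ l, v ∈ S

/-- If `S` separates `A` from `B`, a path from `A` whose only vertex in `S` is its last vertex
meets a path to `B` whose only vertex in `S` is its first vertex at most in their common end. -/
theorem Separates.mem_inter {E : Finset (V × V)} {A B S : Finset V} (hS : Separates E A B S)
    {p q : List V} {c d v : V}
    (hp : (p ++ [c]).IsChain (fun a b => (a, b) ∈ E)) (hpa : ∃ a ∈ A, ∃ t, p ++ [c] = a :: t)
    (hq : (d :: q).IsChain (fun a b => (a, b) ∈ E)) (hqb : ∃ b ∈ B, ∃ s, d :: q = s ++ [b])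
    (hpS : ∀ w ∈ p, w ∉ S) (hqS : ∀ w ∈ q, w ∉ S)
    (hv₁ : v ∈ p ++ [c]) (hv₂ : v ∈ d :: q) : v ∈ S ∧ c = v ∧ d = v := by
  obtain ⟨p₁, p₂, hpp⟩ := List.append_of_mem hv₁
  obtain ⟨q₁, q₂, hqq⟩ := List.append_of_mem hv₂
  have hp₁ : ∀ w ∈ p₁, w ∉ S := by
    intro w hw
    apply hpS
    have h2 := congrArg List.dropLast hpp
    rw [List.dropLast_concat, List.dropLast_append_of_ne_nil (by simp)] at h2
    simp [h2, hw]
  have hq₂ : ∀ w ∈ q₂, w ∉ S := by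
    intro w hw
    apply hqS
    have h2 := congrArg List.tail hqq
    simp only [List.tail_cons] at h2
    cases q₁ <;> simp_all
  have hvS : v ∈ S := by
    have hlink : IsLink E A B (p₁ ++ v :: q₂) := by
      refine ⟨?_, ?_, ?_⟩
      · rw [hpp] at hp
        rw [hqq] at hq
        rw [List.isChain_split] at hp hq ⊢
        exact ⟨hp.1, hq.2⟩
      · obtain ⟨a, ha, t, hat⟩ := hpa
        refine ⟨a, ha, ?_⟩
        rw [hpp] at hat
        cases p₁ <;> simp at hat <;> simp [hat.1]
      · obtain ⟨b, hb, t, hbt⟩ := hqb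
        refine ⟨b, hb, ?_⟩
        rw [hqq] at hbt
        exact exists_append_eq_concat hbt _
    obtain ⟨w, hw, hwS⟩ := hS _ hlink
    simp only [List.mem_append, List.mem_cons] at hw
    rcases hw with hw | rfl | hw
    · exact (hp₁ _ hw hwS).elim
    · exact hwS
    · exact (hq₂ _ hw hwS).elim
  refine ⟨hvS, ?_, ?_⟩
  · simp only [List.mem_append, List.mem_singleton] at hv₁
    exact (hv₁.resolve_left (fun h => hpS _ h hvS)).symm
  · simp only [List.mem_cons] at hv₂
    exact (hv₂.resolve_right (fun h => hqS _ h hvS)).symm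

variable [DecidableEq V]

theorem isChain_of_notMem_left {E : Finset (V × V)} {x y : V} {s : List V} {v : V}
    (h : (s ++ [v]).IsChain (fun a b => (a, b) ∈ insert (x, y) E)) (hx : x ∉ s) :
    (s ++ [v]).IsChain (fun a b => (a, b) ∈ E) := by
  rw [List.isChain_iff_forall_rel_of_append_cons_cons] at h ⊢
  intro a b l₁ l₂ hl
  have := h hl
  rw [Finset.mem_insert] at this
  refine this.resolve_left ?_
  rintro hab
  obtain ⟨rfl, rfl⟩ := Prod.mk.inj hab
  apply hx
  have h2 := congrArg List.dropLast hl
  rw [List.dropLast_concat] at h2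
  rw [h2, List.dropLast_append_of_ne_nil (by simp)]
  simp

theorem isChain_of_notMem_right {E : Finset (V × V)} {x y : V} {t : List V} {v : V}
    (h : (v :: t).IsChain (fun a b => (a, b) ∈ insert (x, y) E)) (hy : y ∉ t) :
    (v :: t).IsChain (fun a b => (a, b) ∈ E) := by
  rw [List.isChain_iff_forall_rel_of_append_cons_cons] at h ⊢
  intro a b l₁ l₂ hl
  have := h hl
  rw [Finset.mem_insert] at this
  refine this.resolve_left ?_
  rintro hab
  obtain ⟨rfl, rfl⟩ := Prod.mk.inj hab
  apply hy
  cases l₁ <;> simp at hl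
  · simp [hl.2]
  · simp [hl.2]

theorem Separates.insert_left {E : Finset (V × V)} {A B S : Finset V} {x y : V}
    (h : Separates E A B S) : Separates (insert (x, y) E) A B (insert x S) := by
  rintro l ⟨hc, ha, b, hb, s, rfl⟩
  by_cases hx : x ∈ s
  · exact ⟨x, by simp [hx], by simp⟩
  · obtain ⟨v, hv, hvS⟩ := h _ ⟨isChain_of_notMem_left hc hx, ha, b, hb, s, rfl⟩
    exact ⟨v, hv, by simp [hvS]⟩

theorem Separates.insert_right {E : Finset (V × V)} {A B S : Finset V} {x y : V}
    (h : Separates E A B S) : Separates (insert (x, y) E) A B (insert y S) := by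
  rintro l ⟨hc, ⟨a, ha, t, rfl⟩, hb⟩
  by_cases hy : y ∈ t
  · exact ⟨y, by simp [hy], by simp⟩
  · obtain ⟨v, hv, hvS⟩ := h _ ⟨isChain_of_notMem_right hc hy, ⟨a, ha, t, rfl⟩, hb⟩
    exact ⟨v, hv, by simp [hvS]⟩

/-- Cut a walk at its first vertex in `S`. Since `x ∈ S`, the piece up to there cannot use the edge
`(x, y)`, so it is a walk in `E` and meets `T`. -/
theorem Separates.trans_left {E : Finset (V × V)} {A B S T : Finset V} {x y : V}
    (hS : Separates (insert (x, y) E) A B S) (hx : x ∈ S) (hT : Separates E A S T) :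
    Separates (insert (x, y) E) A B T := by
  intro l hl
  obtain ⟨s, v, t, rfl, hv, hs⟩ := exists_first_mem_split (· ∈ S) l (hS l hl)
  obtain ⟨hc, ⟨a, ha, t', hat⟩, -⟩ := hl
  have hc' : (s ++ [v]).IsChain (fun a b => (a, b) ∈ insert (x, y) E) :=
    hc.prefix ⟨t, by simp⟩
  have hhead : ∃ t, s ++ [v] = a :: t := by
    cases s <;> simp at hat <;> simp [hat.1]
  obtain ⟨w, hw, hwT⟩ := hT (s ++ [v]) ⟨isChain_of_notMem_left hc' (fun h => hs _ h hx),
    ⟨a, ha, hhead⟩, v, hv, s, rfl⟩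
  exact ⟨w, by simp at hw ⊢; tauto, hwT⟩

theorem Separates.trans_right {E : Finset (V × V)} {A B S T : Finset V} {x y : V}
    (hS : Separates (insert (x, y) E) A B S) (hy : y ∈ S) (hT : Separates E S B T) :
    Separates (insert (x, y) E) A B T := by
  intro l hl
  obtain ⟨s, v, t, rfl, hv, hs⟩ := exists_last_mem_split (· ∈ S) l (hS l hl)
  obtain ⟨hc, -, ⟨b, hb, t', hat⟩⟩ := hl
  have hc' : (v :: t).IsChain (fun a b => (a, b) ∈ insert (x, y) E) :=
    hc.suffix ⟨s, by simp⟩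
  have hlast : ∃ s, v :: t = s ++ [b] := exists_append_eq_concat hat []
  obtain ⟨w, hw, hwT⟩ := hT (v :: t) ⟨isChain_of_notMem_right hc' (fun h => hs _ h hy),
    ⟨v, hv, t, rfl⟩, b, hb, hlast⟩
  exact ⟨w, by simp at hw ⊢; tauto, hwT⟩

/-- Menger's theorem for directed graphs with a finite set of edges, in terms of vertex lists. -/
theorem exists_disjoint_links (E : Finset (V × V)) : ∀ (A B : Finset V) (k : ℕ),
    (∀ S, Separates E A B S → k ≤ S.card) →
    ∃ P : Fin k → List V, (∀ i, IsLink E A B (P i) ∧ (P i).Nodup) ∧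
      ∀ i j v, v ∈ P i → v ∈ P j → i = j := by
  induction E using Finset.induction_on with
  | empty =>
    intro A B k h
    have hk : k ≤ (A ∩ B).card := by
      apply h
      rintro l ⟨hc, ⟨a, ha, t, rfl⟩, b, hb, s, hs⟩
      cases t with
      | cons c t => simp at hc
      | nil =>
        refine ⟨a, by simp, ?_⟩
        have := congrArg List.getLast? hs
        simp at this
        subst this
        simp [ha, hb]
    obtain ⟨T, hT, hTk⟩ := Finset.exists_subset_card_eq hk
    refine ⟨fun i => [((T.equivFinOfCardEq hTk).symm i : V)], fun i => ⟨⟨by simp, ?_, ?_⟩, by simp⟩,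
      ?_⟩
    · exact ⟨_, (Finset.mem_inter.1 (hT ((T.equivFinOfCardEq hTk).symm i).2)).1, [], rfl⟩
    · exact ⟨_, (Finset.mem_inter.1 (hT ((T.equivFinOfCardEq hTk).symm i).2)).2, [], rfl⟩
    · intro i j v hi hj
      simp only [List.mem_singleton] at hi hj
      exact (T.equivFinOfCardEq hTk).symm.injective (Subtype.ext (hi.symm.trans hj))
  | insert e E _ ih =>
    obtain ⟨x, y⟩ := e
    intro A B k h
    have mono : ∀ {l C D}, IsLink E C D l → IsLink (insert (x, y) E) C D l :=
      fun hl => ⟨hl.1.imp fun _ _ h => Finset.mem_insert_of_mem h, hl.2⟩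
    by_cases hE : ∀ S, Separates E A B S → k ≤ S.card
    · obtain ⟨P, hP, hd⟩ := ih A B k hE
      exact ⟨P, fun i => ⟨mono (hP i).1, (hP i).2⟩, hd⟩
    -- Without the new edge some `S` with fewer than `k` vertices separates. Adding either end of
    -- the edge restores a separator, so `S` has exactly `k - 1` vertices and contains neither end.
    push Not at hE
    obtain ⟨S, hS, hSk⟩ := hE
    have hSx := hS.insert_left (x := x) (y := y)
    have hSy := hS.insert_right (x := x) (y := y)
    have hxS : x ∉ S := fun hx => by
      have := h _ hSx
      rw [Finset.insert_eq_of_mem hx] at this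
      omega
    have hyS : y ∉ S := fun hy => by
      have := h _ hSy
      rw [Finset.insert_eq_of_mem hy] at this
      omega
    have hcx : (insert x S).card = k := by
      have := h _ hSx
      rw [Finset.card_insert_of_notMem hxS] at this ⊢
      omega
    have hcy : (insert y S).card = k := by
      rw [Finset.card_insert_of_notMem hyS, ← hcx, Finset.card_insert_of_notMem hxS]
    obtain ⟨P, hP, hPd⟩ := ih A (insert x S) k
      fun T hT => h T (hSx.trans_left (Finset.mem_insert_self _ _) hT)
    obtain ⟨Q, hQ, hQd⟩ := ih (insert y S) B k
      fun T hT => h T (hSy.trans_right (Finset.mem_insert_self _ _) hT)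
    have hPE := fun i => (hP i).1.1
    have hPA := fun i => (hP i).1.2.1
    have hPn := fun i => (hP i).2
    choose f hf p hp using fun i => (hP i).1.2.2
    have hQE := fun i => (hQ i).1.1
    have hQB := fun i => (hQ i).1.2.2
    have hQn := fun i => (hQ i).2
    choose g hg q hq using fun i => (hQ i).1.2.1
    clear hP hQ ih
    obtain rfl : P = fun i => p i ++ [f i] := funext hp
    obtain rfl : Q = fun i => g i :: q i := funext hq
    clear hp hq
    dsimp only at *
    have hf_inj : Function.Injective f := fun i j hij => hPd i j (f i) (by simp) (by simp [hij])
    have hg_inj : Function.Injective g := fun i j hij => hQd i j (g i) (by simp) (by simp [hij])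
    have hf_surj : ∀ s ∈ insert x S, ∃ i, f i = s := by
      have : Finset.univ.image f = insert x S := Finset.eq_of_subset_of_card_le
        (by simpa [Finset.subset_iff] using hf)
        (by rw [hcx, Finset.card_image_of_injective _ hf_inj]; simp)
      intro s hs
      simpa [← this] using hs
    have hg_surj : ∀ s ∈ insert y S, ∃ i, g i = s := by
      have : Finset.univ.image g = insert y S := Finset.eq_of_subset_of_card_le
        (by simpa [Finset.subset_iff] using hg)
        (by rw [hcy, Finset.card_image_of_injective _ hg_inj]; simp)
      intro s hs
      simpa [← this] using hs
    have hpS : ∀ i, ∀ w ∈ p i, w ∉ S := by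
      intro i w hw hwS
      obtain ⟨j, rfl⟩ := hf_surj w (by simp [hwS])
      obtain rfl := hPd i j (f j) (by simp [hw]) (by simp)
      have := hPn i
      simp [List.nodup_append] at this
      exact this.2 _ hw rfl
    have hqS : ∀ i, ∀ w ∈ q i, w ∉ S := by
      intro i w hw hwS
      obtain ⟨j, rfl⟩ := hg_surj w (by simp [hwS])
      obtain rfl := hQd i j (g j) (by simp [hw]) (by simp)
      have := hQn i
      simp at this
      exact this.1 hw
    have key : ∀ i j v, v ∈ p i ++ [f i] → v ∈ g j :: q j → v ∈ S ∧ f i = v ∧ g j = v :=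
      fun i j v => hS.mem_inter (hPE i) (hPA i) (hQE j) (hQB j) (hpS i) (hqS j)
    -- Match the path ending at `s ∈ S` with the one starting at `s`, and the path ending at `x`
    -- with the one starting at `y`.
    have hτ : ∀ i, ∃ j, g j = if f i = x then y else f i := by
      intro i
      apply hg_surj
      have := hf i
      split_ifs with hx
      · simp
      · simp only [Finset.mem_insert, hx, false_or] at this
        simp [this]
    choose τ hτ using hτ
    have hτ_inj : Function.Injective τ := by
      intro i j hij
      apply hf_inj
      have hi := hτ i
      rw [hij, hτ j] at hi
      have h₁ := hf i
      have h₂ := hf j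
      rw [Finset.mem_insert] at h₁ h₂
      grind
    -- At `x` the two paths are joined by the new edge; elsewhere they share a vertex, which must be
    -- listed only once.
    let R : Fin k → List V := fun i =>
      p i ++ [f i] ++ (if f i = x then g (τ i) :: q (τ i) else q (τ i))
    have hR : ∀ i v, v ∈ R i → v ∈ p i ++ [f i] ∨ v ∈ g (τ i) :: q (τ i) := by
      intro i v hv
      rcases List.mem_append.1 hv with h | h
      · exact Or.inl h
      · right
        split_ifs at h
        · exact h
        · exact List.mem_cons_of_mem _ h
    have hcross : ∀ i j v, v ∈ p i ++ [f i] → v ∈ g (τ j) :: q (τ j) → i = j := by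
      intro i j v hi hj
      obtain ⟨hvS, h₁, h₂⟩ := key i (τ j) v hi hj
      apply hf_inj
      have := hτ j
      grind
    refine ⟨R, fun i => ⟨⟨?_, ?_, ?_⟩, ?_⟩, ?_⟩
    · have h₁ := (hPE i).imp
        (S := fun a b => (a, b) ∈ insert (x, y) E) fun _ _ h => Finset.mem_insert_of_mem h
      have h₂ := (hQE (τ i)).imp
        (S := fun a b => (a, b) ∈ insert (x, y) E) fun _ _ h => Finset.mem_insert_of_mem h
      have h₃ := hτ i
      dsimp only [R]
      split_ifs at h₃ ⊢ with hx
      · rw [List.append_assoc, List.singleton_append, List.isChain_append_cons_cons]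
        refine ⟨h₁, ?_, h₂⟩
        simp [hx, h₃]
      · rw [List.append_assoc, List.singleton_append, List.isChain_split]
        exact ⟨h₁, h₃ ▸ h₂⟩
    · obtain ⟨a, ha, t, hat⟩ := hPA i
      exact ⟨a, ha, t ++ _, by dsimp only [R]; rw [hat]; rfl⟩
    · obtain ⟨b, hb, s, hs⟩ := hQB (τ i)
      refine ⟨b, hb, ?_⟩
      have h₃ := hτ i
      dsimp only [R]
      split_ifs at h₃ ⊢ with hx
      · exact ⟨p i ++ [f i] ++ s, by rw [hs]; simp⟩
      · exact ⟨p i ++ s, by rw [List.append_assoc, List.singleton_append, ← h₃, hs]; simp⟩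
    · have h₃ := hτ i
      dsimp only [R]
      have hn := hQn (τ i)
      rw [List.nodup_append]
      split_ifs at h₃ ⊢ with hx
      · refine ⟨hPn i, hn, ?_⟩
        rintro v hv _ hv' rfl
        obtain ⟨hvS, h₁, -⟩ := key i (τ i) v hv hv'
        rw [← h₁, hx] at hvS
        exact hxS hvS
      · refine ⟨hPn i, hn.of_cons, ?_⟩
        rintro v hv _ hv' rfl
        exact hqS _ v hv' (key i (τ i) v hv (List.mem_cons_of_mem _ hv')).1
    · intro i j v hi hj
      rcases hR i v hi with hi | hi <;> rcases hR j v hj with hj | hj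
      · exact hPd i j v hi hj
      · exact hcross i j v hi hj
      · exact (hcross j i v hj hi).symm
      · exact hτ_inj (hQd _ _ v hi hj)

end Menger

/-! ### Fans and detours along a longest path -/

section PathEccentricity

variable {V : Type*} {G : SimpleGraph V}

theorem exists_walk_length_of_isChain {u w : V} {l : List V}
    (h : (u :: l ++ [w]).IsChain G.Adj) : ∃ p : G.Walk u w, p.length = l.length + 1 := by
  induction l generalizing u with
  | nil => exact ⟨(List.isChain_pair.1 h).toWalk, rfl⟩
  | cons a l ih =>
    obtain ⟨p, hp⟩ := ih h.tail
    exact ⟨Walk.cons (List.isChain_cons_cons.1 h).1 p, by simp [hp]⟩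

theorem exists_isChain_of_connected_induce {s : Set V} (h : (G.induce s).Connected) {u w : V}
    (hu : u ∈ s) (hw : w ∈ s) :
    ∃ t : List V, (u :: t).IsChain G.Adj ∧ (u :: t).Nodup ∧ w ∈ u :: t ∧ ∀ v ∈ u :: t, v ∈ s := by
  obtain ⟨p, hp⟩ := h.exists_isPath ⟨u, hu⟩ ⟨w, hw⟩
  have hcons : u :: p.support.tail.map Subtype.val = p.support.map Subtype.val :=
    congrArg (List.map Subtype.val) p.cons_tail_support
  refine ⟨p.support.tail.map Subtype.val, ?_⟩
  rw [hcons]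
  refine ⟨List.isChain_map_of_isChain (S := G.Adj) Subtype.val (fun a b h => h)
    p.isChain_adj_support, hp.support_nodup.map Subtype.val_injective,
    List.mem_map_of_mem (f := Subtype.val) p.end_mem_support, fun v hv => ?_⟩
  obtain ⟨a, -, rfl⟩ := List.mem_map.1 hv
  exact a.2

variable [Fintype V]

/-- The fan lemma: a vertex `u` outside a set `W` of at least `k` vertices of a `k`-connected graph
is joined to `k` vertices of `W` by paths that share only `u` and have no inner vertex in `W`. -/
theorem IsKConnected.exists_fan {k : ℕ} (hG : G.IsKConnected k) {u : V} {W : Finset V}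
    (hu : u ∉ W) (hW : k ≤ W.card) :
    ∃ (p : Fin k → List V) (w : Fin k → V), (∀ i, w i ∈ W) ∧ Function.Injective w ∧
      (∀ i, (u :: p i ++ [w i]).IsChain G.Adj) ∧ (∀ i, (u :: p i).Nodup) ∧
      (∀ i, ∀ v ∈ p i, v ∉ W) ∧ ∀ i j v, v ∈ p i → v ∈ p j → i = j := by
  classical
  -- No edge leaves `W` or enters `u`, so links from the neighbours of `u` to `W` stop at their
  -- first vertex in `W` and avoid `u`.
  let E : Finset (V × V) := {e | G.Adj e.1 e.2 ∧ e.1 ∉ W ∧ e.2 ≠ u}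
  let A : Finset V := {v | G.Adj u v}
  have hsep : ∀ S, Separates E A W S → k ≤ S.card := by
    intro S hS
    by_contra! hk
    obtain ⟨w, hwW, hwS⟩ : ∃ w ∈ W, w ∉ S :=
      Finset.exists_mem_notMem_of_card_lt_card (hk.trans_le hW)
    -- The set `S` may contain `u`, which has to survive as the start of the path; the rest of the
    -- path avoids `u` anyway.
    obtain ⟨t, ht, htn, hwt, htS⟩ := exists_isChain_of_connected_induce
      (hG.2 (S.erase u) ((Finset.card_erase_le).trans_lt hk)) (u := u) (w := w)
      (by simp) (by simp [hwS])
    have hut := (List.nodup_cons.1 htn).1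
    have hwt' : w ∈ t := (List.mem_cons.1 hwt).resolve_left (by rintro rfl; exact hu hwW)
    obtain ⟨s, v, r, rfl, hv, hs⟩ := exists_first_mem_split (· ∈ W) t ⟨w, hwt', hwW⟩
    have hlink : IsLink E A W (s ++ [v]) := by
      refine ⟨?_, ?_, v, hv, s, rfl⟩
      · have hadj : (s ++ [v]).IsChain G.Adj := ht.tail.prefix ⟨r, by simp⟩
        rw [List.isChain_iff_forall_rel_of_append_cons_cons] at hadj ⊢
        intro a b l₁ l₂ hl
        refine Finset.mem_filter.2 ⟨Finset.mem_univ _, hadj hl, hs _ ?_, ?_⟩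
        · have h2 := congrArg List.dropLast hl
          rw [List.dropLast_concat, List.dropLast_append_of_ne_nil (by simp)] at h2
          rw [h2]
          simp
        · rintro rfl
          apply hut
          rw [List.append_cons, hl]
          simp
      · cases s with
        | nil => exact ⟨v, by simpa [A] using (List.isChain_cons_cons.1 ht).1, [], rfl⟩
        | cons c s => exact ⟨c, by simpa [A] using (List.isChain_cons_cons.1 ht).1, s ++ [v], rfl⟩
    obtain ⟨z, hz, hzS⟩ := hS _ hlink
    have hzt : z ∈ s ++ v :: r := by
      rw [List.append_cons]
      exact List.mem_append_left _ hz
    have := htS z (List.mem_cons_of_mem _ hzt)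
    simp only [Finset.mem_erase, Set.mem_ofPred_eq, not_and] at this
    exact this (fun h => hut (h ▸ hzt)) hzS
  obtain ⟨P, hP, hPd⟩ := exists_disjoint_links E A W k hsep
  have hPE := fun i => (hP i).1.1
  have hPA := fun i => (hP i).1.2.1
  have hPn := fun i => (hP i).2
  choose w hw p hp using fun i => (hP i).1.2.2
  clear hP
  obtain rfl : P = fun i => p i ++ [w i] := funext hp
  clear hp
  dsimp only at *
  have hPadj : ∀ i, (p i ++ [w i]).IsChain G.Adj := fun i =>
    (hPE i).imp fun a b h => (Finset.mem_filter.1 h).2.1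
  refine ⟨p, w, hw, fun i j hij => hPd i j (w i) (by simp) (by simp [hij]), ?_, ?_, ?_, ?_⟩
  · intro i
    obtain ⟨a, ha, t, hat⟩ := hPA i
    rw [List.cons_append, hat, List.isChain_cons_cons, ← hat]
    exact ⟨(Finset.mem_filter.1 ha).2, hPadj i⟩
  · intro i
    rw [List.nodup_cons]
    refine ⟨fun hui => ?_, (List.nodup_append.1 (hPn i)).1⟩
    obtain ⟨s, t, hst⟩ := List.append_of_mem hui
    obtain ⟨a, ha, t', hat⟩ := hPA i
    rcases List.eq_nil_or_concat s with rfl | ⟨s', c, rfl⟩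
    · rw [hst] at hat
      simp at hat
      rw [← hat.1] at ha
      exact G.loopless.irrefl _ (Finset.mem_filter.1 ha).2
    · have h : p i ++ [w i] = s' ++ c :: u :: (t ++ [w i]) := by rw [hst]; simp
      have := List.isChain_iff_forall_rel_of_append_cons_cons.1 (hPE i) h
      exact (Finset.mem_filter.1 this).2.2.2 rfl
  · intro i v hv
    obtain ⟨s, t, hst⟩ := List.append_of_mem hv
    obtain ⟨c, t', hct⟩ : ∃ c t', t ++ [w i] = c :: t' := by cases t <;> simp
    have h : p i ++ [w i] = s ++ v :: c :: t' := by rw [hst, ← hct]; simp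
    have := List.isChain_iff_forall_rel_of_append_cons_cons.1 (hPE i) h
    exact (Finset.mem_filter.1 this).2.2.1
  · intro i j v hi hj
    exact hPd i j v (by simp [hi]) (by simp [hj])

/-- If `L` had fewer than `k` vertices, deleting all but its first would leave a connected graph
with another vertex. The first vertex would then have a neighbour off `L`, extending the path. -/
theorem IsKConnected.le_length_of_maximal {k : ℕ} (hG : G.IsKConnected k) {L : List V}
    (hne : L ≠ []) (hL : L.IsChain G.Adj) (hLn : L.Nodup)
    (hmax : ∀ l : List V, l.IsChain G.Adj → l.Nodup → l.length ≤ L.length) : k ≤ L.length := by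
  classical
  by_contra! hk
  obtain ⟨a, t, rfl⟩ := List.exists_cons_of_ne_nil hne
  have hat : a ∉ t := (List.nodup_cons.1 hLn).1
  obtain ⟨z, -, hz⟩ : ∃ z ∈ (Finset.univ : Finset V), z ∉ (a :: t).toFinset :=
    Finset.exists_mem_notMem_of_card_lt_card
      ((List.toFinset_card_le _).trans_lt (hk.trans (by simpa using hG.1)))
  obtain ⟨s, hs, -, hzs, hst⟩ := exists_isChain_of_connected_induce (hG.2 t.toFinset
    ((List.toFinset_card_le _).trans_lt ((by simp : t.length < (a :: t).length).trans hk)))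
    (u := a) (w := z) (by simpa using hat) (by simp at hz ⊢; tauto)
  cases s with
  | nil => simp at hzs hz; tauto
  | cons b s =>
    have hab := (List.isChain_cons_cons.1 hs).1
    have hb : b ∉ t := by simpa using hst b (by simp)
    have := hmax (b :: a :: t) (List.isChain_cons_cons.2 ⟨hab.symm, hL⟩)
      (List.nodup_cons.2 ⟨by simp [hb, hab.ne'], hLn⟩)
    simp at this

/-- `k` positions in `{0, …, m - 1}` that are at least `d + 1` apart from each other and have at
least `d` positions on either side need `m ≥ k + (k + 1) d`. -/
theorem mul_add_le_of_separated {k d m : ℕ} (hk : 0 < k) (x : Fin k → ℕ) (h₁ : ∀ i, d ≤ x i)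
    (h₂ : ∀ i, x i + 1 + d ≤ m) (h : ∀ i j, x i < x j → x i + 1 + d ≤ x j)
    (hinj : Function.Injective x) : k * (d + 1) + d ≤ m := by
  -- Each position, together with the `d` positions before it, forms a block. The blocks are
  -- disjoint and miss the last `d` positions.
  have hcard : (Finset.univ.biUnion fun i => Finset.Icc (x i - d) (x i)).card = k * (d + 1) := by
    rw [Finset.card_biUnion]
    · rw [Finset.sum_congr rfl (g := fun _ => d + 1)]
      · simp
      · intro i _
        have := h₁ i
        rw [Nat.card_Icc]
        omega
    · intro i _ j _ hij
      rw [Function.onFun, Finset.disjoint_left]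
      intro a ha hb
      rw [Finset.mem_Icc] at ha hb
      rcases lt_or_gt_of_ne (hinj.ne hij) with hlt | hlt
      · have := h _ _ hlt
        omega
      · have := h _ _ hlt
        omega
  have hsub : (Finset.univ.biUnion fun i => Finset.Icc (x i - d) (x i)) ⊆ Finset.range (m - d) := by
    intro a ha
    simp only [Finset.mem_biUnion, Finset.mem_univ, true_and, Finset.mem_Icc] at ha
    obtain ⟨i, hi⟩ := ha
    have := h₂ i
    rw [Finset.mem_range]
    omega
  have := Finset.card_le_card hsub
  rw [hcard, Finset.card_range] at this
  have := h₂ ⟨0, hk⟩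
  omega

theorem IsKConnected.card_ge_of_dist_maximal {k r : ℕ} (hk : 2 ≤ k) (hr : 1 ≤ r)
    (hG : G.IsKConnected k) {L : List V} (hne : L ≠ []) (hL : L.IsChain G.Adj) (hLn : L.Nodup)
    (hmax : ∀ l : List V, l.IsChain G.Adj → l.Nodup → l.length ≤ L.length) {u : V}
    (hu : ∀ v ∈ L, r ≤ G.dist u v) : (3 * k + 2) * r ≤ Fintype.card V + k := by
  classical
  have hkL := hG.le_length_of_maximal hne hL hLn hmax
  have huL : u ∉ L := fun h => by
    have := hu u h
    rw [dist_self] at this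
    omega
  obtain ⟨p, w, hw, hw_inj, hp, hpn, hpL, hpd⟩ := hG.exists_fan (u := u) (W := L.toFinset)
    (by simpa using huL) (by rwa [List.toFinset_card_of_nodup hLn])
  simp only [List.mem_toFinset] at hw hpL
  have hlen : ∀ i, r ≤ (p i).length + 1 := fun i => by
    obtain ⟨q, hq⟩ := exists_walk_length_of_isChain (hp i)
    exact (hu _ (hw i)).trans (hq ▸ dist_le q)
  have hM : ∀ i j, ((w i :: ((p i).reverse ++ u :: p j)) ++ [w j]).IsChain G.Adj := by
    intro i j
    have h₁ : (w i :: (p i).reverse ++ [u]).IsChain G.Adj := by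
      have : (w i :: (p i).reverse ++ [u]) = (u :: p i ++ [w i]).reverse := by simp
      rw [this, List.isChain_reverse]
      exact (hp i).imp fun _ _ h => h.symm
    have : w i :: ((p i).reverse ++ u :: p j) ++ [w j] =
      (w i :: (p i).reverse) ++ u :: (p j ++ [w j]) := by simp
    rw [this, List.isChain_split]
    exact ⟨h₁, hp j⟩
  have hMn : ∀ i j, i ≠ j → ((p i).reverse ++ u :: p j).Nodup := by
    intro i j hij
    rw [List.nodup_append]
    refine ⟨List.nodup_reverse.2 (hpn i).of_cons, hpn j, ?_⟩
    rintro v hv _ hv' rfl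
    rw [List.mem_reverse] at hv
    rcases List.mem_cons.1 hv' with rfl | hv'
    · exact (List.nodup_cons.1 (hpn i)).1 hv
    · exact hij (hpd i j v hv hv')
  have hML : ∀ i j, ∀ v ∈ (p i).reverse ++ u :: p j, v ∉ L := by
    intro i j v hv
    simp only [List.mem_append, List.mem_reverse, List.mem_cons] at hv
    rcases hv with hv | rfl | hv
    · exact hpL i v hv
    · exact huL
    · exact hpL j v hv
  have hMlen : ∀ i j, 2 * r - 1 ≤ ((p i).reverse ++ u :: p j).length := by
    intro i j
    have := hlen i
    have := hlen j
    simp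
    omega
  generalize hMdef : (fun i j => (p i).reverse ++ u :: p j) = M at *
  have hMdef' : ∀ i j, (p i).reverse ++ u :: p j = M i j := fun i j => by rw [← hMdef]
  simp only [hMdef'] at hM hMn hML hMlen
  -- This is where `2 ≤ k` enters: replacing an end of `L` by a detour needs a second fan path.
  have hother : ∀ i : Fin k, ∃ j, j ≠ i := fun i => by
    have : Nontrivial (Fin k) := Fin.nontrivial_iff_two_le.2 hk
    exact exists_ne i
  choose a b hab using fun i => List.append_of_mem (hw i)
  have hleft : ∀ i, 2 * r - 1 ≤ (a i).length := by
    intro i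
    obtain ⟨j, hj⟩ := hother i
    -- The part of `L` before `w i` is replaced by the detour, without its far foot `w j`.
    have h := hmax (M j i ++ w i :: b i) ?_ ?_
    · rw [hab i] at h
      have := hMlen j i
      simp at h
      omega
    · rw [List.isChain_split]
      refine ⟨(hM j i).tail, ?_⟩
      exact hL.suffix ⟨a i, (hab i).symm⟩
    · rw [List.nodup_append]
      refine ⟨hMn j i hj, hLn.sublist (by rw [hab i]; simp), ?_⟩
      rintro v hv _ hv' rfl
      exact hML _ _ v hv (by rw [hab i]; exact List.mem_append_right _ hv')
  have hright : ∀ i, 2 * r - 1 ≤ (b i).length := by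
    intro i
    obtain ⟨j, hj⟩ := hother i
    have h := hmax (a i ++ w i :: M i j) ?_ ?_
    · rw [hab i] at h
      have := hMlen i j
      simp at h
      omega
    · rw [List.isChain_split]
      refine ⟨hL.prefix ⟨b i, by rw [hab i]; simp⟩, ?_⟩
      exact (hM i j).prefix ⟨[w j], by simp⟩
    · rw [List.append_cons, List.nodup_append]
      refine ⟨hLn.sublist (by rw [hab i, List.append_cons]; simp), hMn i j hj.symm, ?_⟩
      rintro v hv _ hv' rfl
      exact hML _ _ v hv' (by rw [hab i, List.append_cons]; exact List.mem_append_left _ hv)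
  have hmid : ∀ i j, (a i).length < (a j).length →
      (a i).length + 1 + (2 * r - 1) ≤ (a j).length := by
    intro i j hij
    have hne : i ≠ j := fun h => by simp [h] at hij
    obtain ⟨c, hc₁, hc₂⟩ : ∃ c, a j = a i ++ w i :: c ∧ b i = c ++ w j :: b j := by
      have h := (hab i).symm.trans (hab j)
      rcases List.append_eq_append_iff.1 h with ⟨c, h₁, h₂⟩ | ⟨c, h₁, h₂⟩
      · cases c with
        | nil => simp [h₁] at hij
        | cons d c =>
          simp only [List.cons_append, List.cons.injEq] at h₂
          exact ⟨c, by rw [h₁, h₂.1], h₂.2⟩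
      · simp [h₁] at hij
    have hLeq : L = a i ++ w i :: c ++ w j :: b j := by rw [← hc₁]; exact hab j
    -- The stretch `c` of `L` between the two feet is replaced by the detour.
    have h := hmax (a i ++ w i :: M i j ++ w j :: b j) ?_ ?_
    · rw [hLeq] at h
      have := hMlen i j
      simp at h
      rw [hc₁]
      simp
      omega
    · rw [List.isChain_split, List.append_assoc, List.cons_append, List.isChain_split]
      refine ⟨⟨?_, hM i j⟩, ?_⟩
      · exact hL.prefix ⟨b i, by rw [hab i]; simp⟩
      · exact hL.suffix ⟨a j, (hab j).symm⟩
    · have hperm : (a i ++ w i :: M i j ++ w j :: b j).Perm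
          (M i j ++ (a i ++ [w i] ++ w j :: b j)) := by
        have : a i ++ w i :: M i j ++ w j :: b j = (a i ++ [w i]) ++ M i j ++ w j :: b j := by simp
        rw [this, ← List.append_assoc (M i j)]
        exact List.perm_append_comm.append_right _
      have hsub : (a i ++ [w i] ++ w j :: b j).Sublist L := by
        rw [hLeq, List.append_cons (a i) (w i) c]
        exact (List.sublist_append_left _ _).append_right _
      rw [hperm.nodup_iff, List.nodup_append]
      refine ⟨hMn i j hne, hLn.sublist hsub, ?_⟩
      rintro v hv _ hv' rfl
      exact hML _ _ v hv (hsub.subset hv')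
  have hinj : Function.Injective fun i => (a i).length := by
    intro i j hij
    have h := (hab i).symm.trans (hab j)
    have := (List.append_inj h hij).2
    exact hw_inj (List.cons.inj this).1
  have hLlen := mul_add_le_of_separated (by omega) (fun i => (a i).length) (m := L.length)
    (d := 2 * r - 1) hleft (fun i => by
      have := hright i
      have := congrArg List.length (hab i)
      simp at this ⊢
      omega) hmid hinj
  have hsum : k * (r - 1) ≤ (Finset.univ.biUnion fun i => (p i).toFinset).card := by
    rw [Finset.card_biUnion]
    · have : ∀ i ∈ Finset.univ, r - 1 ≤ (p i).toFinset.card := fun i _ => by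
        rw [List.toFinset_card_of_nodup (hpn i).of_cons]
        have := hlen i
        omega
      simpa using Finset.card_nsmul_le_sum _ _ _ this
    · intro i _ j _ hij
      rw [Function.onFun, Finset.disjoint_left]
      intro v hv hv'
      exact hij (hpd i j v (by simpa using hv) (by simpa using hv'))
  have hdisj₁ : u ∉ (Finset.univ.biUnion fun i => (p i).toFinset) := by
    simp only [Finset.mem_biUnion, Finset.mem_univ, true_and, List.mem_toFinset, not_exists]
    exact fun i => (List.nodup_cons.1 (hpn i)).1
  have hdisj₂ : Disjoint L.toFinset
      (insert u (Finset.univ.biUnion fun i => (p i).toFinset)) := by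
    rw [Finset.disjoint_right]
    intro v hv
    simp only [Finset.mem_insert, Finset.mem_biUnion, Finset.mem_univ, true_and,
      List.mem_toFinset] at hv ⊢
    rcases hv with rfl | ⟨i, hi⟩
    · exact huL
    · exact hpL i v hi
  have hcard := Finset.card_le_univ
    (L.toFinset ∪ insert u (Finset.univ.biUnion fun i => (p i).toFinset))
  rw [Finset.card_union_of_disjoint hdisj₂, Finset.card_insert_of_notMem hdisj₁,
    List.toFinset_card_of_nodup hLn] at hcard
  obtain ⟨s, rfl⟩ : ∃ s, r = s + 1 := ⟨r - 1, by omega⟩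
  have e₁ : 2 * (s + 1) - 1 = 2 * s + 1 := by omega
  rw [e₁] at hLlen
  rw [Nat.add_sub_cancel] at hsum
  -- With `r = s + 1`, the terms `k * 2r + (2r - 1)` for `L`, `1` for `u` and `k * (r - 1)` for the
  -- fan add up to `(3k + 2)r - k`.
  nlinarith

variable (G) in
theorem exists_longest_path [Nonempty V] : ∃ L : List V, L ≠ [] ∧ L.IsChain G.Adj ∧ L.Nodup ∧
    ∀ l : List V, l.IsChain G.Adj → l.Nodup → l.length ≤ L.length := by
  obtain ⟨a, b, p, hp, hmax⟩ 
    := Walk.exists_isPath_forall_isPath_length_le_length G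
  refine ⟨p.support, p.support_ne_nil, p.isChain_adj_support, hp.support_nodup, fun l hl hn => ?_⟩
  rcases eq_or_ne l [] with rfl | hne
  · simp
  · have := hmax _ _ (Walk.ofSupport l hne hl) (Walk.IsPath.mk' (by rwa [Walk.support_ofSupport]))
    rw [Walk.length_ofSupport] at this
    rw [Walk.length_support]
    omega

theorem IsKConnected.mul_pathEccentricity_le {k : ℕ} (hk : 2 ≤ k) (hG : G.IsKConnected k) :
    (3 * k + 2) * G.pathEccentricity ≤ Fintype.card V + k := by
  rcases Nat.eq_zero_or_pos G.pathEccentricity with h0 | hpos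
  · simp [h0]
  have : Nonempty V := Fintype.card_pos_iff.1 (by have := hG.1; omega)
  obtain ⟨L, hne, hL, hLn, hmax⟩ := exists_longest_path G
  have hecc : G.pathEccentricity ≤ G.setEccentricity {v | v ∈ L} :=
    Nat.sInf_le ⟨_, _, Walk.ofSupport L hne hL, Walk.IsPath.mk' (by rwa [Walk.support_ofSupport]),
      by rw [Walk.support_ofSupport]⟩
  obtain ⟨u, -, hu⟩ := (Finset.le_sup_iff hpos).1 hecc
  exact hG.card_ge_of_dist_maximal hk hpos hne hL hLn hmax (u := u)
    fun v hv => hu.trans (Nat.sInf_le ⟨v, hv, rfl⟩)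

end PathEccentricity

end SimpleGraph

theorem mainTheorem1 {V : Type*} [Fintype V] (G : SimpleGraph V) (k : ℕ) (hk : 2 ≤ k)
    (hG : G.IsKConnected k) :
    (G.pathEccentricity : ℝ) ≤ ((Fintype.card V : ℝ) + (k : ℝ)) / (3 * (k : ℝ) + 2) := by
  rw [le_div_iff₀ (by positivity), mul_comm]
  exact_mod_cast hG.mul_pathEccentricity_le hk
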